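/- Let $\alpha>\tfrac12$, let $k\ge 0$ be an integer, and let $\mathbf P_k^{(\alpha,\alpha)}$ be the orthonormal ultraspherical (Jacobi) polynomial of degree $k$, i.e. the Jacobi polynomial $P_k^{(\alpha,\alpha)}$ normalized so that $\int_{-1}^1 (1-x^2)^\alpha\,\mathbf P_k^{(\alpha,\alpha)}(x)^2\,dx=1$. Put $$\delta=\sqrt{1-\frac{4\alpha^2-1}{(2k+2\alpha+1)^2-4}}\,.$$ Then $$\max_{-\delta\le x\le\delta}\ \sqrt{\delta^2-x^2}\,(1-x^2)^\alpha\left(\mathbf P_k^{(\alpha,\alpha)}(x)\right)^2<\begin{cases}\dfrac2\pi\left(1+\dfrac1{8(k+\alpha)^2}\right), & k\ge 2 \text{ even},\\[2ex] \dfrac{230}{\pi}, & k\ge 3\text{ odd}.\end{cases}$$ Moreover, for every $k\ge 0$, all local maxima on $[-1,1]$ of the function $x\mapsto(1-x^2)^{\alpha+1/2}\left(\mathbf P_k^{(\alpha,\alpha)}(x)\right)^2$ lie inside the interval $(-\delta,\delta)$. -/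

import Mathlib

open Set Polynomial

/-- The Jacobi polynomial `P_n^{(α,β)}` in the standard normalization (`P_n^{(α,β)}(1) = binom(n+α, n)`):
`∑_{m ≤ n} (n+α+β+1)_m (α+m+1)_{n-m} / (m! (n-m)!) ((x-1)/2)^m`, `(a)_m` the rising factorial. It is
orthogonal on `[-1, 1]` with respect to `(1-x)^α (1+x)^β` when `α, β > -1`. -/
noncomputable def jacobiP (α β : ℝ) (n : ℕ) : ℝ[X] :=
  ∑ m ∈ Finset.range (n + 1),
    C ((ascPochhammer ℝ m).eval (n + α + β + 1) * (ascPochhammer ℝ (n - m)).eval (α + m + 1) /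
        ((m.factorial : ℝ) * ((n - m).factorial : ℝ))) *
      (C (1 / 2) * (X - 1)) ^ m

/-- The squared norm of `P_n^{(α,β)}` in `L²([-1, 1], (1-x)^α (1+x)^β dx)`. -/
noncomputable def jacobiNormSq (α β : ℝ) (n : ℕ) : ℝ :=
  ∫ x in (-1 : ℝ)..1, (1 - x) ^ α * (1 + x) ^ β * ((jacobiP α β n).eval x) ^ 2

/-- The orthonormal Jacobi polynomial: `P_n^{(α,β)}` divided by its norm. -/
noncomputable def orthonormalJacobi (α β : ℝ) (n : ℕ) : ℝ[X] :=
  C (Real.sqrt (jacobiNormSq α β n))⁻¹ * jacobiP α β n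

/-- `M_k^α(x, d) = √(d² - x²) (1 - x²)^α 𝐏_k^{(α,α)}(x)²`, meaningful for `|x| ≤ d ≤ 1`. -/
noncomputable def ultraM (α : ℝ) (k : ℕ) (d x : ℝ) : ℝ :=
  Real.sqrt (d ^ 2 - x ^ 2) * (1 - x ^ 2) ^ α * ((orthonormalJacobi α α k).eval x) ^ 2

/-- `δ = √(1 - (4α² - 1) / ((2k + 2α + 1)² - 4))`. -/
noncomputable def ultraDelta (α : ℝ) (k : ℕ) : ℝ :=
  Real.sqrt (1 - (4 * α ^ 2 - 1) / ((2 * k + 2 * α + 1) ^ 2 - 4))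

/-!
Write `p` for a polynomial solution of the ultraspherical equation
`(1 - x²) p'' - 2 (α + 1) x p' + k (k + 2α + 1) p = 0`, and put `N = k + α + 1/2`, `c = 1 - δ²`, so
that `c (N² - 1) = α² - 1/4`. Everything is derived from the equation and is independent of the
normalization of `p`; orthogonality is never needed.

**Reduction to the origin.** In the variable `t` with `dx/dt = (1 - x²) / √(δ² - x²)` the function
`v = (δ² - x²)^(1/4) (1 - x²)^(α/2) p` satisfies `v_tt + D v = 0` with
`D = N² + c / B + (c / 2) (1 + 2x²) / B² + (5/4) c² x² / B³`, `B = δ² - x²`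
(`sonin_ode`). No term of `D` decreases as `|x|` grows, so the Sonin function `v² + v_t² / D`
decreases away from the origin, and `v²`, which is the function to be bounded, is at most its value at `0`
(`IsUltraspherical.weighted_sq_le`). For even `k` this is `δ p(0)²`; for odd `k` it is
at most `δ p'(0)² / (N² - α² + 1/4)`.

**Values at the origin.** If `p` solves the equation with parameters `(α, k)`, then `p'` solves it with
`(α + 1, k - 1)`, and integration by parts relates the two weighted norms
(`IsUltraspherical.weightedNormSq_derivative`). The equation at `x = 0` relates `p''(0)` to `p(0)`.
Induction on `m` gives `π p(0)² = N g(m) g(m + α)` for a normalized `p` of degree `2m`, where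
`g(x) = Γ(x + 1/2) / Γ(x + 1)` (`IsUltraspherical.eval_zero_sq`), and the odd case is reduced to this
one through `p'`. Watson's bound `g(x)² ≤ 1 / (x + 1/4)` (`gammaRatio_sq_le`) then yields the two
estimates `even_bound` and `odd_bound`.

**Local maxima.** With `x = cos θ`, `w = (1 - x²)^((α + 1/2)/2) p` satisfies `w_θθ + q w = 0` where
`q = 1 + (N² - 1) (δ² - x²) / (1 - x²)` is at most `1` for `x ≥ δ`. Comparison with `sin θ` shows that
`w / sin θ` has no zero and is monotone there (`IsUltraspherical.pos_of_delta_le`), so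
`(1 - x²)^(α + 1/2) p²` has negative derivative on `[δ, 1)`; the rest follows by symmetry.
-/

/-! ### Polynomial solutions of the ultraspherical differential equation -/

/-- `p` has degree at most `k` and solves the ultraspherical equation
`(1 - x²) p'' - 2 (α + 1) x p' + k (k + 2α + 1) p = 0`. For `α > -1` this determines `p` up to a
scalar factor; no normalization is fixed. -/
def IsUltraspherical (α : ℝ) (k : ℕ) (p : ℝ[X]) : Prop :=
  p.natDegree ≤ k ∧
    (1 - X ^ 2) * derivative (derivative p) - C (2 * (α + 1)) * X * derivative p +
      C (k * (k + 2 * α + 1)) * p = 0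

/-- The coefficients of `P_k^{(α,α)}` in powers of `(x - 1) / 2`. -/
noncomputable def jacobiCoeff (α : ℝ) (k m : ℕ) : ℝ :=
  (ascPochhammer ℝ m).eval (k + α + α + 1) * (ascPochhammer ℝ (k - m)).eval (α + m + 1) /
    ((m.factorial : ℝ) * ((k - m).factorial : ℝ))

lemma jacobiCoeff_succ (α : ℝ) {k m : ℕ} (h : m < k) :
    ((m : ℝ) + 1) * (m + α + 1) * jacobiCoeff α k (m + 1) =
      (k - m) * (k + m + 2 * α + 1) * jacobiCoeff α k m := by
  obtain ⟨j, rfl⟩ := Nat.exists_eq_add_of_lt h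
  have e1 : m + j + 1 - (m + 1) = j := by omega
  have e2 : m + j + 1 - m = j + 1 := by omega
  have e3 : (ascPochhammer ℝ (j + 1)).eval (α + m + 1) =
      (α + m + 1) * (ascPochhammer ℝ j).eval (α + m + 1 + 1) := by
    simp [ascPochhammer_succ_left, eval_comp]
  unfold jacobiCoeff
  rw [e1, e2, e3, ascPochhammer_succ_eval, Nat.factorial_succ, Nat.factorial_succ]
  have h1 : (m.factorial : ℝ) ≠ 0 := by positivity
  have h2 : (j.factorial : ℝ) ≠ 0 := by positivity
  have h3 : α + ((m + 1 : ℕ) : ℝ) + 1 = α + m + 1 + 1 := by push_cast; ring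
  rw [h3]
  push_cast
  field_simp
  ring

/-- In the variable `t = (x - 1) / 2` the ultraspherical equation reads
`t (1 + t) q'' + (α + 1) (1 + 2t) q' = k (k + 2α + 1) q`. -/
lemma jacobiCoeff_ode (α : ℝ) (k : ℕ) (q : ℝ[X])
    (hq : q = ∑ m ∈ Finset.range (k + 1), C (jacobiCoeff α k m) * X ^ m) :
    X * derivative (derivative q) + X ^ 2 * derivative (derivative q) +
      C (α + 1) * derivative q + C (2 * (α + 1)) * (X * derivative q) -
      C (k * (k + 2 * α + 1)) * q = 0 := by
  have hc (n : ℕ) : q.coeff n = if n < k + 1 then jacobiCoeff α k n else 0 := by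
    simp [hq, coeff_X_pow]
  have hrec (n : ℕ) : ((n : ℝ) + 1) * (n + α + 1) * q.coeff (n + 1) =
      (k - n) * (k + n + 2 * α + 1) * q.coeff n := by
    rw [hc, hc]
    rcases lt_trichotomy n k with h | rfl | h
    · rw [if_pos (by omega), if_pos (by omega), jacobiCoeff_succ α h]
    · simp
    · rw [if_neg (by omega), if_neg (by omega)]; simp
  clear hc hq
  ext n
  have h := hrec n
  rcases n with _ | _ | n
  · simp [coeff_derivative] at h ⊢
    linear_combination h
  · have e : (X ^ 2 * derivative (derivative q)).coeff 1 = 0 := by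
      rw [coeff_X_pow_mul']; simp
    simp only [coeff_sub, coeff_add, coeff_X_mul, coeff_C_mul, coeff_derivative, e, coeff_zero,
      zero_add]
    push_cast at h ⊢
    linear_combination h
  · have e : (X ^ 2 * derivative (derivative q)).coeff (n + 2) =
        (derivative (derivative q)).coeff n := coeff_X_pow_mul _ 2 n
    simp only [coeff_sub, coeff_add, coeff_X_mul, coeff_C_mul, coeff_derivative, e, coeff_zero]
    push_cast at h ⊢
    linear_combination h

lemma jacobiP_eq_comp (α : ℝ) (k : ℕ) :
    jacobiP α α k =
      (∑ m ∈ Finset.range (k + 1), C (jacobiCoeff α k m) * X ^ m).comp (C (1 / 2) * (X - 1)) := by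
  simp [jacobiP, jacobiCoeff, Polynomial.sum_comp]

lemma isUltraspherical_jacobiP (α : ℝ) (k : ℕ) : IsUltraspherical α k (jacobiP α α k) := by
  set q : ℝ[X] := ∑ m ∈ Finset.range (k + 1), C (jacobiCoeff α k m) * X ^ m with hq
  set l : ℝ[X] := C (1 / 2) * (X - 1) with hl
  have hl' : derivative l = C (1 / 2) := by simp [hl]
  constructor
  · rw [jacobiP_eq_comp]
    refine natDegree_comp_le.trans ?_
    have h1 : q.natDegree ≤ k := by
      refine natDegree_sum_le_of_forall_le _ _ fun m hm => ?_
      exact (natDegree_C_mul_X_pow_le _ _).trans (by have := Finset.mem_range.1 hm; omega)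
    have h2 : l.natDegree ≤ 1 := by
      rw [hl, show (X - 1 : ℝ[X]) = X - C 1 by simp]
      exact (natDegree_C_mul_le _ _).trans (natDegree_X_sub_C_le _)
    calc _ ≤ k * 1 := Nat.mul_le_mul h1 h2
      _ = k := mul_one k
  · have h := congrArg (fun r => r.comp l) (jacobiCoeff_ode α k q hq)
    simp only [sub_comp, add_comp, mul_comp, X_comp, C_comp, pow_comp, zero_comp] at h
    rw [jacobiP_eq_comp, derivative_comp, derivative_mul, derivative_comp, hl', derivative_C]
    have hX : (X : ℝ[X]) = 1 + 2 * l := by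
      have : (2 : ℝ[X]) * C (1 / 2) = 1 := by
        rw [← map_ofNat C 2, ← Polynomial.C_mul, ← C_1]; norm_num
      rw [hl, ← mul_assoc, this]; ring
    have h2 : (C (1 / 2) : ℝ[X]) * 2 = 1 := by
      rw [← map_ofNat C 2, ← Polynomial.C_mul, ← C_1]; norm_num
    have hC : (C (2 * (α + 1)) : ℝ[X]) = 2 * C (α + 1) := by rw [Polynomial.C_mul, map_ofNat]
    rw [hC] at h ⊢
    generalize (derivative (derivative q)).comp l = q2 at *
    generalize (derivative q).comp l = q1 at *
    generalize q.comp l = q0 at *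
    clear_value l
    rw [hX]
    generalize (C (1 / 2) : ℝ[X]) = d at *
    linear_combination (-1 : ℝ[X]) * h +
      (-(2 * d + 1) * l * (1 + l) * q2 - C (α + 1) * (1 + 2 * l) * q1) * h2

namespace IsUltraspherical

variable {α : ℝ} {k : ℕ} {p : ℝ[X]}

lemma C_mul (h : IsUltraspherical α k p) (a : ℝ) : IsUltraspherical α k (C a * p) := by
  refine ⟨(natDegree_C_mul_le _ _).trans h.1, ?_⟩
  have := h.2
  simp only [derivative_C_mul]
  linear_combination C a * this

lemma eval_ode (h : IsUltraspherical α k p) (x : ℝ) :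
    (1 - x ^ 2) * (derivative (derivative p)).eval x - 2 * (α + 1) * x * (derivative p).eval x +
      k * (k + 2 * α + 1) * p.eval x = 0 := by
  simpa using congrArg (eval x) h.2

/-- The derivative of a solution solves the equation with `α + 1` and `k - 1`. -/
lemma diff (h : IsUltraspherical α (k + 1) p) :
    IsUltraspherical (α + 1) k (Polynomial.derivative p) := by
  refine ⟨(natDegree_derivative_le p).trans (by have := h.1; omega), ?_⟩
  have h2 := congrArg Polynomial.derivative h.2
  have h2C : (Polynomial.C 2 : ℝ[X]) = 2 := map_ofNat Polynomial.C 2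
  simp [derivative_mul, h2C] at h2 ⊢
  linear_combination h2

/-- Solutions of degree `k` have the parity of `k`. -/
lemma eval_neg (h : IsUltraspherical α k p) (hα : -1 < α) (x : ℝ) :
    p.eval (-x) = (-1) ^ k * p.eval x := by
  suffices H : p.comp (-X) = (-1) ^ k * p by simpa using congrArg (eval x) H
  induction k generalizing α p with
  | zero => rw [eq_C_of_natDegree_le_zero h.1]; simp
  | succ k ih =>
    have h1 := ih h.diff (by linarith)
    -- Differentiating the parity of `p'` gives that of `p''`, and the equation then gives that of `p`.
    have h2 := congrArg Polynomial.derivative h1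
    have h3 := congrArg (fun r => r.comp (-X)) h.2
    have h4 := h.2
    simp only [sub_comp, add_comp, mul_comp, X_comp, C_comp, pow_comp, zero_comp, one_comp] at h3
    rw [derivative_comp] at h2
    have e : Polynomial.derivative ((-1 : ℝ[X]) ^ k * Polynomial.derivative p) =
        (-1) ^ k * Polynomial.derivative (Polynomial.derivative p) := by
      rw [show ((-1 : ℝ[X]) ^ k) = Polynomial.C ((-1) ^ k) by simp, derivative_C_mul]
    rw [e] at h2
    simp only [derivative_neg, derivative_X] at h2
    have hne : (Polynomial.C (((k + 1 : ℕ) : ℝ) * (((k + 1 : ℕ) : ℝ) + 2 * α + 1)) : ℝ[X]) ≠ 0 := by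
      rw [Ne, C_eq_zero]
      have : (0 : ℝ) ≤ k := k.cast_nonneg
      push_cast
      exact (mul_pos (by linarith) (by linarith)).ne'
    refine mul_left_cancel₀ hne ?_
    rw [pow_succ]
    rw [h1] at h3
    linear_combination h3 + (1 - X ^ 2) * h2 + (-1) ^ k * h4

end IsUltraspherical

/-! ### The squared norm and the values at the origin -/

/-- The squared norm of `p` in `L²([-1, 1], (1 - x²)^α dx)`. -/
noncomputable def weightedNormSq (α : ℝ) (p : ℝ[X]) : ℝ :=
  ∫ x in (-1 : ℝ)..1, (1 - x ^ 2) ^ α * p.eval x ^ 2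

lemma jacobiNormSq_eq (α : ℝ) (k : ℕ) :
    jacobiNormSq α α k = weightedNormSq α (jacobiP α α k) := by
  refine intervalIntegral.integral_congr fun x hx => ?_
  rw [uIcc_of_le (by norm_num)] at hx
  rw [← Real.mul_rpow (by linarith [hx.2]) (by linarith [hx.1])]
  ring_nf

lemma continuous_one_sub_sq_rpow {α : ℝ} (hα : 0 ≤ α) :
    Continuous fun x : ℝ => (1 - x ^ 2) ^ α :=
  (by fun_prop : Continuous fun x : ℝ => 1 - x ^ 2).rpow_const fun _ => Or.inr hα

lemma hasDerivAt_sub_sq_rpow (a : ℝ) {b x : ℝ} (hx : x ^ 2 < b) :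
    HasDerivAt (fun x : ℝ => (b - x ^ 2) ^ a) (-(2 * a * x) / (b - x ^ 2) * (b - x ^ 2) ^ a) x := by
  have h : HasDerivAt (fun x : ℝ => b - x ^ 2) (-(2 * x)) x := by
    simpa using (hasDerivAt_pow 2 x).const_sub b
  have hne : b - x ^ 2 ≠ 0 := by linarith
  refine (h.rpow_const (p := a) (Or.inl hne)).congr_deriv ?_
  rw [Real.rpow_sub_one hne]
  ring

lemma weightedNormSq_pos {α : ℝ} (hα : 0 ≤ α) {p : ℝ[X]} (hp : p.eval 1 ≠ 0) :
    0 < weightedNormSq α p := by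
  have hp0 : p ≠ 0 := by rintro rfl; simp at hp
  have hcont : Continuous fun x : ℝ => (1 - x ^ 2) ^ α * p.eval x ^ 2 :=
    (continuous_one_sub_sq_rpow hα).mul (p.continuous.pow 2)
  obtain ⟨c, hc, hcp⟩ : ∃ c ∈ Ioo (-1 : ℝ) 1, p.eval c ≠ 0 := by
    by_contra! H
    exact hp0 (p.eq_zero_of_infinite_isRoot
      ((Ioo_infinite (by norm_num : (-1 : ℝ) < 1)).mono fun x hx => H x hx))
  refine intervalIntegral.integral_pos (by norm_num) hcont.continuousOn (fun x hx => ?_)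
    ⟨c, Ioo_subset_Icc_self hc, ?_⟩
  · have : (0 : ℝ) ≤ 1 - x ^ 2 := by nlinarith [hx.1, hx.2]
    positivity
  · have : (0 : ℝ) < 1 - c ^ 2 := by nlinarith [hc.1, hc.2]
    positivity

/-- Integration by parts against the equation in its self-adjoint form
`((1 - x²)^(α+1) p')' = -k (k + 2α + 1) (1 - x²)^α p`. -/
lemma IsUltraspherical.weightedNormSq_derivative {α : ℝ} {k : ℕ} {p : ℝ[X]}
    (h : IsUltraspherical α k p) (hα : 0 < α) :
    weightedNormSq (α + 1) (Polynomial.derivative p) =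
      k * (k + 2 * α + 1) * weightedNormSq α p := by
  have hc1 : Continuous fun x : ℝ => (1 - x ^ 2) ^ (α + 1) * (Polynomial.derivative p).eval x ^ 2 :=
    (continuous_one_sub_sq_rpow (by linarith)).mul ((Polynomial.derivative p).continuous.pow 2)
  have hc2 : Continuous fun x : ℝ => (1 - x ^ 2) ^ α * p.eval x ^ 2 :=
    (continuous_one_sub_sq_rpow hα.le).mul (p.continuous.pow 2)
  have key := intervalIntegral.integral_eq_sub_of_hasDerivAt_of_le (a := -1) (b := 1)
    (f := fun x : ℝ => (1 - x ^ 2) ^ (α + 1) * ((Polynomial.derivative p).eval x * p.eval x))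
    (f' := fun x : ℝ => (1 - x ^ 2) ^ (α + 1) * (Polynomial.derivative p).eval x ^ 2 -
      k * (k + 2 * α + 1) * ((1 - x ^ 2) ^ α * p.eval x ^ 2)) (by norm_num)
    ((continuous_one_sub_sq_rpow (by linarith)).mul
      ((Polynomial.derivative p).continuous.mul p.continuous)).continuousOn ?_
    ((hc1.sub (hc2.const_mul _)).intervalIntegrable _ _)
  · rw [intervalIntegral.integral_sub (hc1.intervalIntegrable _ _)
      ((hc2.const_mul _).intervalIntegrable _ _), intervalIntegral.integral_const_mul] at key
    have h0 : (0 : ℝ) ^ (α + 1) = 0 := Real.zero_rpow (by linarith)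
    simp only [one_pow, even_two, Even.neg_pow, sub_self, h0, zero_mul] at key
    unfold weightedNormSq
    linarith
  · intro x hx
    have hA : 0 < 1 - x ^ 2 := by nlinarith [hx.1, hx.2]
    have hd := (hasDerivAt_sub_sq_rpow (α + 1) (by linarith : x ^ 2 < 1)).mul
      (((Polynomial.derivative p).hasDerivAt x).mul (p.hasDerivAt x))
    refine hd.congr_deriv ?_
    have ho := h.eval_ode x
    simp only [Pi.mul_apply]
    rw [Real.rpow_add_one hA.ne']
    have hcancel : -(2 * (α + 1) * x) / (1 - x ^ 2) * ((1 - x ^ 2) ^ α * (1 - x ^ 2)) =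
        -(2 * (α + 1) * x) * (1 - x ^ 2) ^ α := by field_simp
    rw [hcancel]
    linear_combination (1 - x ^ 2) ^ α * p.eval x * ho

/-- The quotient `Γ(x + 1/2) / Γ(x + 1)`. -/
noncomputable def gammaRatio (x : ℝ) : ℝ := Real.Gamma (x + 1 / 2) / Real.Gamma (x + 1)

lemma gammaRatio_pos {x : ℝ} (hx : 0 ≤ x) : 0 < gammaRatio x :=
  div_pos (Real.Gamma_pos_of_pos (by linarith)) (Real.Gamma_pos_of_pos (by linarith))

lemma gammaRatio_add_one {x : ℝ} (hx : 0 ≤ x) :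
    gammaRatio (x + 1) = (x + 1 / 2) / (x + 1) * gammaRatio x := by
  unfold gammaRatio
  rw [show x + 1 + 1 / 2 = x + 1 / 2 + 1 by ring, Real.Gamma_add_one (by linarith),
    Real.Gamma_add_one (by linarith : x + 1 ≠ 0), mul_div_mul_comm]

lemma gammaRatio_zero : gammaRatio 0 = √Real.pi := by
  rw [gammaRatio, zero_add, zero_add, Real.Gamma_one_half_eq, Real.Gamma_one, div_one]

/-- Log-convexity of `Γ` at the midpoint of `x` and `x + 1`. -/
lemma mul_gammaRatio_sq_le {x : ℝ} (hx : 0 < x) : x * gammaRatio x ^ 2 ≤ 1 := by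
  have h := Real.Gamma_mul_add_mul_le_rpow_Gamma_mul_rpow_Gamma hx (by linarith : 0 < x + 1)
    (by norm_num : (0 : ℝ) < 1 / 2) (by norm_num : (0 : ℝ) < 1 / 2) (by norm_num)
  have hG := Real.Gamma_pos_of_pos hx
  have hG1 := Real.Gamma_pos_of_pos (by linarith : 0 < x + 1)
  have hG2 := Real.Gamma_pos_of_pos (by linarith : 0 < x + 1 / 2)
  rw [← Real.sqrt_eq_rpow, ← Real.sqrt_eq_rpow, ← Real.sqrt_mul hG.le,
    show 1 / 2 * x + 1 / 2 * (x + 1) = x + 1 / 2 by ring] at h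
  have h2 := (Real.le_sqrt hG2.le (by positivity)).1 h
  unfold gammaRatio
  rw [div_pow, mul_div_assoc', div_le_one (by positivity)]
  calc x * Real.Gamma (x + 1 / 2) ^ 2 ≤ x * (Real.Gamma x * Real.Gamma (x + 1)) := by gcongr
    _ = Real.Gamma (x + 1) ^ 2 := by rw [Real.Gamma_add_one hx.ne']; ring

/-- Watson's bound. The left-hand side increases under `x ↦ x + 1` and tends to `1`. -/
lemma gammaRatio_sq_le {x : ℝ} (hx : 0 ≤ x) : (x + 1 / 4) * gammaRatio x ^ 2 ≤ 1 := by
  have step (y : ℝ) (hy : 0 ≤ y) :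
      (y + 1 / 4) * gammaRatio y ^ 2 ≤ (y + 1 + 1 / 4) * gammaRatio (y + 1) ^ 2 := by
    rw [gammaRatio_add_one hy, mul_pow, ← mul_assoc]
    gcongr
    rw [div_pow, mul_div_assoc', le_div_iff₀ (by positivity)]
    nlinarith
  have iter (n : ℕ) : (x + 1 / 4) * gammaRatio x ^ 2 ≤
      (x + n + 1 / 4) * gammaRatio (x + n) ^ 2 := by
    induction n with
    | zero => simp
    | succ n ih =>
      refine ih.trans ((step _ (by positivity)).trans_eq ?_)
      push_cast
      rw [add_assoc x n 1]
  have bound (n : ℕ) : (x + 1 / 4) * gammaRatio x ^ 2 ≤ 1 + 1 / ((n : ℝ) + 1) := by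
    refine (iter (n + 1)).trans ?_
    have hpos : 0 < x + (n + 1 : ℕ) := by positivity
    have h1 := mul_gammaRatio_sq_le hpos
    have h2 : gammaRatio (x + (n + 1 : ℕ)) ^ 2 ≤ 1 / ((n : ℝ) + 1) := by
      rw [le_div_iff₀ (by positivity)]
      refine le_trans ?_ h1
      rw [mul_comm]
      refine mul_le_mul_of_nonneg_right ?_ (sq_nonneg _)
      push_cast
      linarith
    nlinarith [sq_nonneg (gammaRatio (x + (n + 1 : ℕ)))]
  have lim : Filter.Tendsto (fun n : ℕ => 1 + 1 / ((n : ℝ) + 1)) Filter.atTop (nhds (1 + 0)) :=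
    tendsto_one_div_add_atTop_nhds_zero_nat.const_add 1
  simpa using ge_of_tendsto' lim bound

/-- The Beta integral together with Legendre's duplication formula. -/
lemma integral_one_sub_sq_rpow {b : ℝ} (hb : 0 < b) :
    (b + 1 / 2) * gammaRatio b * ∫ x in (-1 : ℝ)..1, (1 - x ^ 2) ^ b = √Real.pi := by
  have hbeta : ∫ t in (0 : ℝ)..1, t ^ b * (1 - t) ^ b =
      Real.Gamma (b + 1) * Real.Gamma (b + 1) / Real.Gamma (2 * (b + 1)) := by
    have h := Complex.betaIntegral_eq_Gamma_mul_div ((b + 1 : ℝ) : ℂ) ((b + 1 : ℝ) : ℂ)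
      (by rw [Complex.ofReal_re]; linarith) (by rw [Complex.ofReal_re]; linarith)
    have h2 : Complex.betaIntegral ((b + 1 : ℝ) : ℂ) ((b + 1 : ℝ) : ℂ) =
        ((∫ t in (0 : ℝ)..1, t ^ b * (1 - t) ^ b : ℝ) : ℂ) := by
      rw [Complex.betaIntegral, ← intervalIntegral.integral_ofReal]
      refine intervalIntegral.integral_congr fun t ht => ?_
      rw [uIcc_of_le zero_le_one] at ht
      rw [Complex.ofReal_mul, Complex.ofReal_cpow ht.1, Complex.ofReal_cpow (by linarith [ht.2])]
      push_cast
      simp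
    rw [h2, ← Complex.ofReal_add, Complex.Gamma_ofReal, Complex.Gamma_ofReal] at h
    rw [two_mul]
    exact_mod_cast h
  have hsub : ∫ x in (-1 : ℝ)..1, (1 - x ^ 2) ^ b =
      2 * (2 : ℝ) ^ (2 * b) * ∫ t in (0 : ℝ)..1, t ^ b * (1 - t) ^ b := by
    have h := intervalIntegral.integral_comp_mul_sub (a := 0) (b := 1)
      (fun x : ℝ => (1 - x ^ 2) ^ b) (two_ne_zero) 1
    norm_num at h
    have h2 : ∫ x in (0 : ℝ)..1, (1 - (2 * x - 1) ^ 2) ^ b =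
        (2 : ℝ) ^ (2 * b) * ∫ t in (0 : ℝ)..1, t ^ b * (1 - t) ^ b := by
      rw [← intervalIntegral.integral_const_mul]
      refine intervalIntegral.integral_congr fun t ht => ?_
      rw [uIcc_of_le zero_le_one] at ht
      rw [Real.rpow_mul zero_le_two, ← Real.mul_rpow ht.1 (by linarith [ht.2]),
        ← Real.mul_rpow (by positivity) (mul_nonneg ht.1 (by linarith [ht.2]))]
      norm_num
      ring_nf
    rw [h2] at h
    linarith
  have hdup := Real.Gamma_mul_Gamma_add_half (b + 1)
  have hG1 := Real.Gamma_pos_of_pos (by linarith : 0 < b + 1)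
  have hG2 := Real.Gamma_pos_of_pos (by linarith : 0 < 2 * (b + 1))
  have hpow : (2 : ℝ) ^ (2 * b) * 2 * (2 : ℝ) ^ (1 - 2 * (b + 1)) = 1 := by
    rw [← Real.rpow_add_one two_ne_zero, ← Real.rpow_add two_pos]
    ring_nf
    simp
  rw [show b + 1 + 1 / 2 = b + 1 / 2 + 1 by ring,
    Real.Gamma_add_one (by linarith : b + 1 / 2 ≠ 0)] at hdup
  rw [hsub, hbeta, gammaRatio]
  field_simp
  calc _ = (2 : ℝ) ^ (2 * b) * 2 * (Real.Gamma (b + 1) * ((b + 1 / 2) * Real.Gamma (b + 1 / 2))) := by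
        ring_nf
    _ = (2 : ℝ) ^ (2 * b) * 2 * (2 : ℝ) ^ (1 - 2 * (b + 1)) *
        (Real.Gamma (2 * (b + 1)) * √Real.pi) := by
        rw [hdup]; ring
    _ = _ := by rw [hpow]; ring

/-- The value at `0` of a solution of even degree `2m`, relative to its norm. Both sides are compared
with those for `p''`, a solution of degree `2m - 2` with parameter `α + 2`; this leaves the number
`2m + α + 1/2` unchanged. -/
lemma IsUltraspherical.eval_zero_sq {α : ℝ} {m : ℕ} {p : ℝ[X]}
    (h : IsUltraspherical α (2 * m) p) (hα : 0 < α) :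
    Real.pi * p.eval 0 ^ 2 =
      weightedNormSq α p * ((2 * m + α + 1 / 2) * gammaRatio m * gammaRatio (m + α)) := by
  induction m generalizing α p with
  | zero =>
    have hp := eq_C_of_natDegree_le_zero h.1
    have hI := integral_one_sub_sq_rpow hα
    have hpi := Real.mul_self_sqrt Real.pi_pos.le
    rw [hp, weightedNormSq]
    simp only [eval_C, intervalIntegral.integral_mul_const, Nat.cast_zero, gammaRatio_zero]
    simp only [mul_zero, zero_add]
    linear_combination (-p.coeff 0 ^ 2) * hpi - p.coeff 0 ^ 2 * √Real.pi * hI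
  | succ m ih =>
    have h1 := IsUltraspherical.diff (k := 2 * m + 1) h
    have h2 := h1.diff
    have hi := ih h2 (by linarith)
    have hn1 := h.weightedNormSq_derivative hα
    have hn2 := h1.weightedNormSq_derivative (by linarith)
    have ho := h.eval_ode 0
    have hm : (0 : ℝ) ≤ m := m.cast_nonneg
    have hg1 := gammaRatio_add_one hm
    have hg2 := gammaRatio_add_one (by linarith : 0 ≤ (m : ℝ) + α + 1)
    rw [hn2, hn1, show (m : ℝ) + (α + 1 + 1) = m + α + 1 + 1 by ring, hg2] at hi
    push_cast at hi ho ⊢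
    rw [hg1, show (m : ℝ) + 1 + α = m + α + 1 by ring]
    have hp2 : (Polynomial.derivative (Polynomial.derivative p)).eval 0 =
        -((2 * (m + 1)) * (2 * (m + 1) + 2 * α + 1) * p.eval 0) := by linear_combination ho
    rw [hp2] at hi
    have hK : ((2 * ((m : ℝ) + 1)) * (2 * (m + 1) + 2 * α + 1)) ^ 2 ≠ 0 := by positivity
    refine mul_left_cancel₀ hK ?_
    have e : ((2 * ((m : ℝ) + 1)) * (2 * (m + 1) + 2 * α + 1)) ^ 2 * (Real.pi * p.eval 0 ^ 2) =
      Real.pi * (-((2 * (m + 1)) * (2 * (m + 1) + 2 * α + 1) * p.eval 0)) ^ 2 := by ring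
    rw [e, hi]
    field_simp
    ring

/-! ### The parameter `δ` -/

/-- The number `1 - δ²`. -/
noncomputable def ultraGap (α : ℝ) (k : ℕ) : ℝ :=
  (4 * α ^ 2 - 1) / ((2 * k + 2 * α + 1) ^ 2 - 4)

lemma one_lt_add_half {α : ℝ} (hα : 1 / 2 < α) (k : ℕ) : 1 < (k : ℝ) + α + 1 / 2 := by
  have : (0 : ℝ) ≤ k := k.cast_nonneg
  linarith

lemma ultraGap_mul {α : ℝ} (hα : 1 / 2 < α) (k : ℕ) :
    ultraGap α k * (((k : ℝ) + α + 1 / 2) ^ 2 - 1) = α ^ 2 - 1 / 4 := by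
  have h := one_lt_add_half hα k
  have hne : (2 * (k : ℝ) + 2 * α + 1) ^ 2 - 4 ≠ 0 := by nlinarith
  rw [ultraGap, div_mul_eq_mul_div, div_eq_iff hne]
  ring

lemma ultraGap_pos {α : ℝ} (hα : 1 / 2 < α) (k : ℕ) : 0 < ultraGap α k := by
  have h := one_lt_add_half hα k
  exact div_pos (by nlinarith) (by nlinarith)

lemma ultraGap_lt_one {α : ℝ} (hα : 1 / 2 < α) (k : ℕ) : ultraGap α k < 1 := by
  have h := one_lt_add_half hα k
  have hk : (0 : ℝ) ≤ k := k.cast_nonneg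
  rw [ultraGap, div_lt_one (by nlinarith)]
  nlinarith

lemma ultraDelta_sq {α : ℝ} (hα : 1 / 2 < α) (k : ℕ) : ultraDelta α k ^ 2 = 1 - ultraGap α k :=
  Real.sq_sqrt (sub_nonneg.2 (ultraGap_lt_one hα k).le)

lemma ultraDelta_pos {α : ℝ} (hα : 1 / 2 < α) (k : ℕ) : 0 < ultraDelta α k :=
  Real.sqrt_pos.2 (sub_pos.2 (ultraGap_lt_one hα k))

/-! ### A Sonin function -/

/-- The coefficient `D` of the equation `v_tt + D v = 0` satisfied by
`v = (δ² - x²)^(1/4) (1 - x²)^(α/2) p` in the variable `t` with `dx/dt = (1 - x²) / √(δ² - x²)`;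
here `c = 1 - δ²` and `N = k + α + 1/2`. -/
noncomputable def soninCoeff (c N x : ℝ) : ℝ :=
  N ^ 2 + c / (1 - c - x ^ 2) + c / 2 * (1 + 2 * x ^ 2) / (1 - c - x ^ 2) ^ 2 +
    5 / 4 * c ^ 2 * x ^ 2 / (1 - c - x ^ 2) ^ 3

lemma soninCoeff_pos {c N x : ℝ} (hc : 0 < c) (hN : 0 < N) (hx : x ^ 2 < 1 - c) :
    0 < soninCoeff c N x := by
  have : 0 < 1 - c - x ^ 2 := by linarith
  unfold soninCoeff
  positivity

/-- `D` increases on `[0, δ)`. -/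
lemma exists_hasDerivAt_soninCoeff {c N x : ℝ} (hc : 0 < c) (hx0 : 0 ≤ x) (hx : x ^ 2 < 1 - c) :
    ∃ d, 0 ≤ d ∧ HasDerivAt (soninCoeff c N) d x := by
  have hB : 0 < 1 - c - x ^ 2 := by linarith
  have hB' : HasDerivAt (fun x : ℝ => 1 - c - x ^ 2) (-(2 * x)) x := by
    simpa using (hasDerivAt_pow 2 x).const_sub (1 - c)
  have hsq : HasDerivAt (fun x : ℝ => x ^ 2) (2 * x) x := by simpa using hasDerivAt_pow 2 x
  have h := (((hasDerivAt_const x c).div hB' hB.ne').const_add (N ^ 2)).add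
    ((((hsq.const_mul 2).const_add 1).const_mul (c / 2)).div (hB'.pow 2) (pow_ne_zero 2 hB.ne')) |>.add
    ((hsq.const_mul (5 / 4 * c ^ 2)).div (hB'.pow 3) (pow_ne_zero 3 hB.ne'))
  refine ⟨4 * c * x / (1 - c - x ^ 2) ^ 2 + 2 * c * x * (1 + 2 * x ^ 2) / (1 - c - x ^ 2) ^ 3 +
    5 / 2 * c ^ 2 * x / (1 - c - x ^ 2) ^ 3 + 15 / 2 * c ^ 2 * x ^ 3 / (1 - c - x ^ 2) ^ 4,
    by positivity, h.congr_deriv ?_⟩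
  simp only [Pi.pow_apply]
  field_simp
  ring

/-- The Sonin function `v² + v_t² / D` of the equation `v_tt + D v = 0`. -/
noncomputable def soninFun (α c N : ℝ) (p : ℝ[X]) (x : ℝ) : ℝ :=
  ((1 - c - x ^ 2) ^ (1 / 4 : ℝ) * (1 - x ^ 2) ^ (α / 2) * p.eval x) ^ 2 +
    ((1 - c - x ^ 2) ^ (-(1 / 4) : ℝ) * (1 - x ^ 2) ^ (α / 2 + 1) *
      ((derivative p).eval x - x * (1 / (2 * (1 - c - x ^ 2)) + α / (1 - x ^ 2)) * p.eval x)) ^ 2 /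
    soninCoeff c N x

/-- The equation `v_tt + D v = 0` after division by a power of `δ² - x²`, as an identity between
the values `P₀, P₁, P₂` of `p, p', p''` at `x`. -/
lemma sonin_ode {α c N x P₀ P₁ P₂ : ℝ} (hA : 0 < 1 - x ^ 2) (hB : 0 < 1 - c - x ^ 2)
    (hrel : c * (N ^ 2 - 1) = α ^ 2 - 1 / 4)
    (hode : (1 - x ^ 2) * P₂ - 2 * (α + 1) * x * P₁ + (N ^ 2 - (α + 1 / 2) ^ 2) * P₀ = 0) :
    (1 - x ^ 2) ^ 2 * ((x / (2 * (1 - c - x ^ 2)) - (α + 2) * x / (1 - x ^ 2)) *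
        (P₁ - x * (1 / (2 * (1 - c - x ^ 2)) + α / (1 - x ^ 2)) * P₀) +
      (P₂ - (1 / (2 * (1 - c - x ^ 2)) + α / (1 - x ^ 2) +
        x * (x / (1 - c - x ^ 2) ^ 2 + 2 * α * x / (1 - x ^ 2) ^ 2)) * P₀ -
        x * (1 / (2 * (1 - c - x ^ 2)) + α / (1 - x ^ 2)) * P₁)) =
    -(soninCoeff c N x * (1 - c - x ^ 2) * P₀) := by
  have key : (1 - x ^ 2) ^ 2 * ((x / (2 * (1 - c - x ^ 2)) - (α + 2) * x / (1 - x ^ 2)) *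
        (P₁ - x * (1 / (2 * (1 - c - x ^ 2)) + α / (1 - x ^ 2)) * P₀) +
      (P₂ - (1 / (2 * (1 - c - x ^ 2)) + α / (1 - x ^ 2) +
        x * (x / (1 - c - x ^ 2) ^ 2 + 2 * α * x / (1 - x ^ 2) ^ 2)) * P₀ -
        x * (1 / (2 * (1 - c - x ^ 2)) + α / (1 - x ^ 2)) * P₁)) +
      soninCoeff c N x * (1 - c - x ^ 2) * P₀ =
    (1 - x ^ 2) * ((1 - x ^ 2) * P₂ - 2 * (α + 1) * x * P₁ + (N ^ 2 - (α + 1 / 2) ^ 2) * P₀) -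
      P₀ * (c * (N ^ 2 - 1) - (α ^ 2 - 1 / 4)) := by
    unfold soninCoeff
    field_simp
    ring
  rw [hode, hrel] at key
  linear_combination key

/-- The derivative of `v² + v_t² / D` is `-(v_t / D)² D'`, the other terms cancelling by the
equation. -/
lemma IsUltraspherical.exists_hasDerivAt_soninFun {α c x : ℝ} {k : ℕ} {p : ℝ[X]}
    (h : IsUltraspherical α k p) (hα : 1 / 2 < α) (hc : 0 < c)
    (hrel : c * (((k : ℝ) + α + 1 / 2) ^ 2 - 1) = α ^ 2 - 1 / 4)
    (hx0 : 0 ≤ x) (hx : x ^ 2 < 1 - c) :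
    ∃ d ≤ 0, HasDerivAt (soninFun α c (k + α + 1 / 2) p) d x := by
  set N : ℝ := k + α + 1 / 2 with hN
  have hNpos : 0 < N := by have := one_lt_add_half hα k; linarith
  have hB : 0 < 1 - c - x ^ 2 := by linarith
  have hA : 0 < 1 - x ^ 2 := by linarith
  have hD := soninCoeff_pos hc hNpos hx
  obtain ⟨d, hd, hD'⟩ := exists_hasDerivAt_soninCoeff (N := N) hc hx0 hx
  have hA' : HasDerivAt (fun x : ℝ => 1 - x ^ 2) (-(2 * x)) x := by
    simpa using (hasDerivAt_pow 2 x).const_sub 1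
  have hB' : HasDerivAt (fun x : ℝ => 1 - c - x ^ 2) (-(2 * x)) x := by
    simpa using (hasDerivAt_pow 2 x).const_sub (1 - c)
  have hβ := hasDerivAt_sub_sq_rpow (1 / 4 : ℝ) hx
  have hγ := hasDerivAt_sub_sq_rpow (-(1 / 4) : ℝ) hx
  have ha := hasDerivAt_sub_sq_rpow (α / 2) (by linarith : x ^ 2 < 1)
  have ha1 := hasDerivAt_sub_sq_rpow (α / 2 + 1) (by linarith : x ^ 2 < 1)
  have hp := p.hasDerivAt x
  have hp' := (derivative p).hasDerivAt x
  have hβγ : ((1 - c - x ^ 2) ^ (1 / 4 : ℝ)) ^ 2 =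
      ((1 - c - x ^ 2) ^ (-(1 / 4) : ℝ)) ^ 2 * (1 - c - x ^ 2) := by
    generalize 1 - c - x ^ 2 = y at hB
    rw [← Real.rpow_natCast, ← Real.rpow_natCast, ← Real.rpow_mul hB.le, ← Real.rpow_mul hB.le,
      ← Real.rpow_add_one hB.ne']
    norm_num
  have hA1 : (1 - x ^ 2) ^ (α / 2 + 1) = (1 - x ^ 2) ^ (α / 2) * (1 - x ^ 2) :=
    Real.rpow_add_one hA.ne' _
  have hode := h.eval_ode x
  have hso := sonin_ode (P₀ := p.eval x) (P₁ := (derivative p).eval x)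
    (P₂ := (derivative (derivative p)).eval x) hA hB hrel (by rw [hN]; linear_combination hode)
  have hr : HasDerivAt (fun x : ℝ => x * (1 / (2 * (1 - c - x ^ 2)) + α / (1 - x ^ 2)))
      (1 / (2 * (1 - c - x ^ 2)) + α / (1 - x ^ 2) +
        x * (x / (1 - c - x ^ 2) ^ 2 + 2 * α * x / (1 - x ^ 2) ^ 2)) x := by
    refine ((hasDerivAt_id x).mul (((hasDerivAt_const x (1 : ℝ)).div
      (hB'.const_mul 2) (by positivity)).add ((hasDerivAt_const x α).div hA' hA.ne'))).congr_deriv ?_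
    simp only [Pi.add_apply, Pi.div_apply, id]
    field_simp
    ring
  have hW := hp'.sub (hr.mul hp)
  set W : ℝ := (derivative p).eval x -
    x * (1 / (2 * (1 - c - x ^ 2)) + α / (1 - x ^ 2)) * p.eval x with hWdef
  have hv : HasDerivAt (fun x => (1 - c - x ^ 2) ^ (1 / 4 : ℝ) * (1 - x ^ 2) ^ (α / 2) * p.eval x)
      ((1 - c - x ^ 2) ^ (1 / 4 : ℝ) * (1 - x ^ 2) ^ (α / 2) * W) x := by
    refine ((hβ.mul ha).mul hp).congr_deriv ?_
    simp only [Pi.mul_apply]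
    rw [hWdef]
    field_simp
    ring
  have hb : HasDerivAt (fun x => (1 - c - x ^ 2) ^ (-(1 / 4) : ℝ) * (1 - x ^ 2) ^ (α / 2 + 1) *
      ((derivative p).eval x - x * (1 / (2 * (1 - c - x ^ 2)) + α / (1 - x ^ 2)) * p.eval x))
      ((1 - c - x ^ 2) ^ (-(1 / 4) : ℝ) * (1 - x ^ 2) ^ (α / 2) / (1 - x ^ 2) *
        -(soninCoeff c N x * (1 - c - x ^ 2) * p.eval x)) x := by
    refine ((hγ.mul ha1).mul hW).congr_deriv ?_
    simp only [Pi.mul_apply, Pi.sub_apply]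
    rw [← hso, ← hWdef, hA1]
    clear_value W
    field_simp
    ring
  refine ⟨-((((1 - c - x ^ 2) ^ (-(1 / 4) : ℝ) * (1 - x ^ 2) ^ (α / 2 + 1) * W) /
    soninCoeff c N x) ^ 2 * d), by have := sq_nonneg (((1 - c - x ^ 2) ^ (-(1 / 4) : ℝ) *
      (1 - x ^ 2) ^ (α / 2 + 1) * W) / soninCoeff c N x); nlinarith, ?_⟩
  refine ((hv.pow 2).add ((hb.pow 2).div hD' hD.ne')).congr_deriv ?_
  simp only [Pi.pow_apply]
  rw [← hWdef, hA1]
  clear_value W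
  generalize soninCoeff c N x = D at *
  generalize (1 - c - x ^ 2) ^ (1 / 4 : ℝ) = β at *
  generalize (1 - c - x ^ 2) ^ (-(1 / 4) : ℝ) = γ at *
  generalize (1 - x ^ 2) ^ (α / 2) = a at *
  push_cast
  field_simp
  linear_combination (2 * a ^ 2 * W * p.eval x * D ^ 2) * hβγ

/-- The weighted square is bounded on `[-δ, δ]` by the value of the Sonin function at the origin. -/
lemma IsUltraspherical.weighted_sq_le {α c x : ℝ} {k : ℕ} {p : ℝ[X]}
    (h : IsUltraspherical α k p) (hα : 1 / 2 < α) (hc : 0 < c)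
    (hrel : c * (((k : ℝ) + α + 1 / 2) ^ 2 - 1) = α ^ 2 - 1 / 4) (hc1 : c < 1)
    (hx : x ^ 2 ≤ 1 - c) :
    √(1 - c - x ^ 2) * (1 - x ^ 2) ^ α * p.eval x ^ 2 ≤
      √(1 - c) * (p.eval 0 ^ 2 +
        (derivative p).eval 0 ^ 2 / (((k : ℝ) + α + 1 / 2) ^ 2 - (α ^ 2 - 1 / 4))) := by
  wlog hx0 : 0 ≤ x generalizing x
  · have := this (x := -x) (by simpa using hx) (by linarith)
    rw [h.eval_neg (by linarith)] at this
    simpa [mul_pow, ← pow_mul, mul_comm k 2] using this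
  set N : ℝ := k + α + 1 / 2 with hN
  have hN1 : 1 < N := one_lt_add_half hα k
  have hgap : 0 < N ^ 2 - (α ^ 2 - 1 / 4) := by
    rw [← hrel]; nlinarith
  -- At `x = δ` the Sonin function is singular, but the left-hand side vanishes.
  rcases hx.eq_or_lt with hx | hx
  · rw [show 1 - c - x ^ 2 = 0 by linarith, Real.sqrt_zero, zero_mul, zero_mul]
    positivity
  have hanti : AntitoneOn (soninFun α c N p) (Icc 0 x) := by
    have hd (y : ℝ) (hy : y ∈ Icc 0 x) : ∃ d ≤ 0, HasDerivAt (soninFun α c N p) d y :=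
      h.exists_hasDerivAt_soninFun hα hc hrel hy.1 (by nlinarith [hy.1, hy.2])
    refine antitoneOn_of_deriv_nonpos (convex_Icc _ _) (fun y hy => ?_) (fun y hy => ?_)
      fun y hy => ?_
    · obtain ⟨d, -, hd⟩ := hd y hy
      exact hd.continuousAt.continuousWithinAt
    · obtain ⟨d, -, hd⟩ := hd y (interior_subset hy)
      exact hd.differentiableAt.differentiableWithinAt
    · obtain ⟨d, hd0, hd⟩ := hd y (interior_subset hy)
      rwa [hd.deriv]
  have hS := hanti (left_mem_Icc.2 hx0) (right_mem_Icc.2 hx0) hx0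
  have hB : 0 < 1 - c - x ^ 2 := by linarith
  have hA : 0 < 1 - x ^ 2 := by linarith
  have hD := soninCoeff_pos (N := N) hc (by linarith) hx
  have hquarter (y : ℝ) (hy : 0 < y) : (y ^ (1 / 4 : ℝ)) ^ 2 = √y := by
    rw [← Real.rpow_natCast, ← Real.rpow_mul hy.le, Real.sqrt_eq_rpow]; norm_num
  have hleft : √(1 - c - x ^ 2) * (1 - x ^ 2) ^ α * p.eval x ^ 2 ≤ soninFun α c N p x := by
    unfold soninFun
    rw [mul_pow, mul_pow, hquarter _ hB, ← Real.rpow_natCast ((1 - x ^ 2) ^ (α / 2)),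
      ← Real.rpow_mul hA.le, Nat.cast_ofNat, div_mul_cancel₀ _ two_ne_zero]
    exact le_add_of_nonneg_right (by positivity)
  have hc0 : 0 < 1 - c := by linarith
  have hright : soninFun α c N p 0 = √(1 - c) * (p.eval 0 ^ 2 +
      (derivative p).eval 0 ^ 2 / ((1 - c) * soninCoeff c N 0)) := by
    have hneg : ((1 - c) ^ (-(1 / 4) : ℝ)) ^ 2 = √(1 - c) / (1 - c) := by
      rw [Real.rpow_neg hc0.le, inv_pow, hquarter _ hc0]
      have := Real.sq_sqrt hc0.le
      have := Real.sqrt_pos.2 hc0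
      field_simp
      linarith
    have hD0 := soninCoeff_pos (N := N) hc (by linarith) (by simpa using hc0 : (0 : ℝ) ^ 2 < 1 - c)
    simp only [soninFun, mul_pow]
    simp only [ne_eq, OfNat.ofNat_ne_zero, not_false_eq_true, zero_pow, sub_zero, Real.one_rpow,
      zero_mul, one_pow, mul_one]
    rw [hneg, hquarter _ hc0]
    field_simp
  refine hleft.trans (hS.trans (hright.trans_le ?_))
  have hle : N ^ 2 - (α ^ 2 - 1 / 4) ≤ (1 - c) * soninCoeff c N 0 := by
    have e : (1 - c) * soninCoeff c N 0 = (1 - c) * N ^ 2 + c + c / 2 / (1 - c) := by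
      simp only [soninCoeff, ne_eq, OfNat.ofNat_ne_zero, not_false_eq_true, zero_pow, sub_zero,
        mul_zero, add_zero, zero_div, mul_one]
      field_simp
    have : 0 < c / 2 / (1 - c) := by positivity
    rw [e]
    linarith
  gcongr

/-! ### The orthonormal polynomial -/

lemma eval_one_jacobiP_pos {α : ℝ} (hα : 0 < α) (k : ℕ) : 0 < (jacobiP α α k).eval 1 := by
  have h : (jacobiP α α k).eval 1 = jacobiCoeff α k 0 := by
    rw [jacobiP_eq_comp]
    simp [eval_finsetSum, Finset.sum_range_succ']
  rw [h, jacobiCoeff]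
  have : 0 < (ascPochhammer ℝ (k - 0)).eval (α + (0 : ℕ) + 1) :=
    ascPochhammer_pos _ _ (by push_cast; linarith)
  simp only [ascPochhammer_zero, eval_one, one_mul]
  positivity

lemma jacobiNormSq_pos {α : ℝ} (hα : 0 < α) (k : ℕ) : 0 < jacobiNormSq α α k := by
  rw [jacobiNormSq_eq]
  exact weightedNormSq_pos hα.le (eval_one_jacobiP_pos hα k).ne'

lemma isUltraspherical_orthonormalJacobi {α : ℝ} (k : ℕ) :
    IsUltraspherical α k (orthonormalJacobi α α k) :=
  (isUltraspherical_jacobiP α k).C_mul _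

lemma eval_one_orthonormalJacobi_ne_zero {α : ℝ} (hα : 0 < α) (k : ℕ) :
    (orthonormalJacobi α α k).eval 1 ≠ 0 := by
  have h1 := Real.sqrt_pos.2 (jacobiNormSq_pos hα k)
  have h2 := eval_one_jacobiP_pos hα k
  rw [orthonormalJacobi, eval_mul, eval_C]
  positivity

lemma weightedNormSq_orthonormalJacobi {α : ℝ} (hα : 0 < α) (k : ℕ) :
    weightedNormSq α (orthonormalJacobi α α k) = 1 := by
  have h := jacobiNormSq_pos hα k
  have e : weightedNormSq α (orthonormalJacobi α α k) =
      ((√(jacobiNormSq α α k))⁻¹) ^ 2 * weightedNormSq α (jacobiP α α k) := by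
    rw [weightedNormSq, weightedNormSq, ← intervalIntegral.integral_const_mul]
    refine intervalIntegral.integral_congr fun x _ => ?_
    simp only [orthonormalJacobi, eval_mul, eval_C]
    ring
  rw [e, ← jacobiNormSq_eq, inv_pow, Real.sq_sqrt h.le, inv_mul_cancel₀ h.ne']

/-! ### Bounds for the maximum on `[-δ, δ]` -/

lemma exists_isGreatest_ultraM_lt {α b B : ℝ} (hα : 0 ≤ α) {k : ℕ} (d : ℝ) (hd : 0 ≤ d)
    (hb : ∀ x ∈ Icc (-d) d, ultraM α k d x ≤ b) (hbB : b < B) :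
    ∃ m, IsGreatest (ultraM α k d '' Icc (-d) d) m ∧ m < B := by
  have hcont : Continuous (ultraM α k d) := by
    unfold ultraM
    exact ((by fun_prop : Continuous fun x : ℝ => √(d ^ 2 - x ^ 2)).mul
      (continuous_one_sub_sq_rpow hα)).mul ((orthonormalJacobi α α k).continuous.pow 2)
  obtain ⟨m, hm⟩ := (isCompact_Icc.image hcont).exists_isGreatest
    ((nonempty_Icc.2 (by linarith : -d ≤ d)).image (ultraM α k d))
  refine ⟨m, hm, ?_⟩
  obtain ⟨x, hx, rfl⟩ := hm.1
  exact (hb x hx).trans_lt hbB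

lemma ultraM_ultraDelta_le {α : ℝ} (hα : 1 / 2 < α) (k : ℕ) {x : ℝ}
    (hx : x ∈ Icc (-ultraDelta α k) (ultraDelta α k)) :
    ultraM α k (ultraDelta α k) x ≤ √(1 - ultraGap α k) *
      ((orthonormalJacobi α α k).eval 0 ^ 2 + (derivative (orthonormalJacobi α α k)).eval 0 ^ 2 /
        (((k : ℝ) + α + 1 / 2) ^ 2 - (α ^ 2 - 1 / 4))) := by
  rw [ultraM, ultraDelta_sq hα]
  refine (isUltraspherical_orthonormalJacobi k).weighted_sq_le hα (ultraGap_pos hα k)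
    (ultraGap_mul hα k) (ultraGap_lt_one hα k) ?_
  rw [← ultraDelta_sq hα]
  exact sq_le_sq' hx.1 hx.2

/-- The bound for even degree. After squaring, Watson's bound reduces it to
`N² (N² - α² - 3/4) ≤ (N² - 3/4) (N² - α²)` and `(k + α)² < N² - 1`. -/
lemma even_bound {α : ℝ} (hα : 1 / 2 < α) {m : ℕ} (hm : 1 ≤ m) :
    √(1 - ultraGap α (2 * m)) * (orthonormalJacobi α α (2 * m)).eval 0 ^ 2 <
      2 / Real.pi * (1 + 1 / (8 * (((2 * m : ℕ) : ℝ) + α) ^ 2)) := by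
  have hm1 : (1 : ℝ) ≤ m := by exact_mod_cast hm
  have hval := (isUltraspherical_orthonormalJacobi (α := α) (2 * m)).eval_zero_sq (by linarith)
  rw [weightedNormSq_orthonormalJacobi (by linarith), one_mul] at hval
  have hgap := ultraGap_mul hα (2 * m)
  have hc1 := ultraGap_lt_one hα (2 * m)
  have hg1 := gammaRatio_sq_le m.cast_nonneg
  have hg2 := gammaRatio_sq_le (by linarith : 0 ≤ (m : ℝ) + α)
  have hp1 := gammaRatio_pos m.cast_nonneg
  have hp2 := gammaRatio_pos (by linarith : 0 ≤ (m : ℝ) + α)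
  push_cast at hgap ⊢
  set N : ℝ := 2 * m + α + 1 / 2 with hN
  set c := ultraGap α (2 * m)
  set g₁ := gammaRatio m
  set g₂ := gammaRatio (m + α)
  have hN1 : 0 < N ^ 2 - 1 := by nlinarith
  have hu : 0 < (2 * (m : ℝ) + α) ^ 2 := by positivity
  have huN : (2 * (m : ℝ) + α) ^ 2 < N ^ 2 - 1 := by rw [hN]; nlinarith
  have hprod : (N ^ 2 - α ^ 2) * (g₁ ^ 2 * g₂ ^ 2) ≤ 4 := by
    have e : (N ^ 2 - α ^ 2) * (g₁ ^ 2 * g₂ ^ 2) =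
        4 * (((m + 1 / 4) * g₁ ^ 2) * ((m + α + 1 / 4) * g₂ ^ 2)) := by rw [hN]; ring
    rw [e]
    have := mul_le_one₀ hg1 (by positivity) hg2
    linarith
  have hN2 : 0 < N ^ 2 - α ^ 2 := by rw [hN]; nlinarith
  have hsq : (√(1 - c) * (N * g₁ * g₂)) ^ 2 ≤ 4 * (1 + 1 / (4 * (N ^ 2 - 1))) := by
    rw [mul_pow, Real.sq_sqrt (by linarith)]
    have h1 : (1 - c) * N ^ 2 * (N ^ 2 - 1) ≤ (N ^ 2 - 3 / 4) * (N ^ 2 - α ^ 2) := by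
      nlinarith [sq_nonneg α]
    have h2 : (1 + 1 / (4 * (N ^ 2 - 1))) * (N ^ 2 - 1) = N ^ 2 - 3 / 4 := by
      field_simp; ring
    refine le_of_mul_le_mul_right ?_ hN1
    calc (1 - c) * (N * g₁ * g₂) ^ 2 * (N ^ 2 - 1)
        = (1 - c) * N ^ 2 * (N ^ 2 - 1) * (g₁ ^ 2 * g₂ ^ 2) := by ring
      _ ≤ (N ^ 2 - 3 / 4) * (N ^ 2 - α ^ 2) * (g₁ ^ 2 * g₂ ^ 2) := by gcongr
      _ = (N ^ 2 - 3 / 4) * ((N ^ 2 - α ^ 2) * (g₁ ^ 2 * g₂ ^ 2)) := by ring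
      _ ≤ (N ^ 2 - 3 / 4) * 4 := by
          refine mul_le_mul_of_nonneg_left hprod (by linarith)
      _ = 4 * (1 + 1 / (4 * (N ^ 2 - 1))) * (N ^ 2 - 1) := by rw [mul_assoc, h2]; ring
  have hlt : √(1 - c) * (N * g₁ * g₂) < 2 * (1 + 1 / (8 * (2 * (m : ℝ) + α) ^ 2)) := by
    refine lt_of_pow_lt_pow_left₀ 2 (by positivity) (hsq.trans_lt ?_)
    have h1 : 1 / (4 * (N ^ 2 - 1)) < 1 / (4 * (2 * (m : ℝ) + α) ^ 2) := by gcongr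
    have h2 : 1 / (4 * (2 * (m : ℝ) + α) ^ 2) = 2 * (1 / (8 * (2 * (m : ℝ) + α) ^ 2)) := by
      field_simp; norm_num
    nlinarith [sq_nonneg (1 / (8 * (2 * (m : ℝ) + α) ^ 2))]
  rw [div_mul_eq_mul_div, lt_div_iff₀ Real.pi_pos]
  calc _ = √(1 - c) * (Real.pi * (orthonormalJacobi α α (2 * m)).eval 0 ^ 2) := by ring
    _ < _ := by rw [hval]; exact hlt

/-- The bound for odd degree, with the crude constant `4`. -/
lemma odd_bound {α : ℝ} (hα : 1 / 2 < α) {m : ℕ} (hm : 1 ≤ m) :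
    √(1 - ultraGap α (2 * m + 1)) *
      ((derivative (orthonormalJacobi α α (2 * m + 1))).eval 0 ^ 2 /
        ((((2 * m + 1 : ℕ) : ℝ) + α + 1 / 2) ^ 2 - (α ^ 2 - 1 / 4))) ≤ 4 / Real.pi := by
  have hm1 : (1 : ℝ) ≤ m := by exact_mod_cast hm
  have hult := isUltraspherical_orthonormalJacobi (α := α) (2 * m + 1)
  have hval := hult.diff.eval_zero_sq (by linarith)
  rw [hult.weightedNormSq_derivative (by linarith),
    weightedNormSq_orthonormalJacobi (by linarith), mul_one] at hval
  have hgap := ultraGap_mul hα (2 * m + 1)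
  have hc0 := ultraGap_pos hα (2 * m + 1)
  have hc1 := ultraGap_lt_one hα (2 * m + 1)
  have hg1 := gammaRatio_sq_le m.cast_nonneg
  have hg2 := gammaRatio_sq_le (by linarith : 0 ≤ (m : ℝ) + (α + 1))
  have hp1 := gammaRatio_pos m.cast_nonneg
  have hp2 := gammaRatio_pos (by linarith : 0 ≤ (m : ℝ) + (α + 1))
  push_cast at hgap hval ⊢
  rw [show (2 * (m : ℝ) + (α + 1) + 1 / 2) = 2 * m + 1 + α + 1 / 2 by ring] at hval
  set N : ℝ := 2 * m + 1 + α + 1 / 2 with hN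
  set c := ultraGap α (2 * m + 1)
  set g₁ := gammaRatio m
  set g₂ := gammaRatio (m + (α + 1))
  have hN2 : 2 ≤ N ^ 2 := by rw [hN]; nlinarith
  have hK : 0 < (2 * (m : ℝ) + 1) * (2 * m + 1 + 2 * α + 1) := by positivity
  have hle : (2 * (m : ℝ) + 1) * (2 * m + 1 + 2 * α + 1) ≤ N ^ 2 - (α ^ 2 - 1 / 4) := by
    rw [hN]; nlinarith
  have hsq : (√(1 - c) * (N * g₁ * g₂)) ^ 2 ≤ 4 ^ 2 := by
    rw [mul_pow, Real.sq_sqrt (by linarith)]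
    have h1 : (1 - c) * N ^ 2 ≤ 16 * ((m + 1 / 4) * (m + (α + 1) + 1 / 4)) := by
      have : (1 - c) * N ^ 2 ≤ 2 * ((1 - c) * (N ^ 2 - 1)) := by nlinarith
      have e : (1 - c) * (N ^ 2 - 1) = N ^ 2 - α ^ 2 - 3 / 4 := by linear_combination -hgap
      rw [e] at this
      refine this.trans ?_
      rw [hN]
      nlinarith
    calc (1 - c) * (N * g₁ * g₂) ^ 2 = (1 - c) * N ^ 2 * (g₁ ^ 2 * g₂ ^ 2) := by ring
      _ ≤ 16 * ((m + 1 / 4) * (m + (α + 1) + 1 / 4)) * (g₁ ^ 2 * g₂ ^ 2) := by gcongr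
      _ = 16 * (((m + 1 / 4) * g₁ ^ 2) * ((m + (α + 1) + 1 / 4) * g₂ ^ 2)) := by ring
      _ ≤ 4 ^ 2 := by
        have := mul_le_one₀ hg1 (by positivity) hg2
        linarith
  have hle4 := (abs_le_of_sq_le_sq' hsq (by norm_num)).2
  rw [le_div_iff₀ Real.pi_pos]
  calc _ = √(1 - c) * ((Real.pi *
        (derivative (orthonormalJacobi α α (2 * m + 1))).eval 0 ^ 2) /
          (N ^ 2 - (α ^ 2 - 1 / 4))) := by ring
    _ ≤ √(1 - c) * ((Real.pi *
        (derivative (orthonormalJacobi α α (2 * m + 1))).eval 0 ^ 2) /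
          ((2 * (m : ℝ) + 1) * (2 * m + 1 + 2 * α + 1))) := by gcongr
    _ = √(1 - c) * (N * g₁ * g₂) := by
      rw [hval, mul_div_cancel_left₀ _ hK.ne']
    _ ≤ 4 := hle4

/-! ### Local maxima -/

/-- Up to the factor `(1 - x²)^(3/2)`, the derivative of `z = (1 - x²)^((α - 1/2)/2) p`. -/
noncomputable def ultraWronskian (α : ℝ) (p : ℝ[X]) (x : ℝ) : ℝ :=
  (1 - x ^ 2) ^ (α / 2 + 1 / 4) *
    ((1 - x ^ 2) * (derivative p).eval x - (α - 1 / 2) * x * p.eval x)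

/-- The equation `w_θθ + q w = 0` in self-adjoint form for `w / sin θ`; the factor `x² - (1 - c)` is
`x² - δ²` and comes from `1 - q`. -/
lemma IsUltraspherical.hasDerivAt_ultraWronskian {α c x : ℝ} {k : ℕ} {p : ℝ[X]}
    (h : IsUltraspherical α k p)
    (hrel : c * (((k : ℝ) + α + 1 / 2) ^ 2 - 1) = α ^ 2 - 1 / 4) (hx : x ^ 2 < 1) :
    HasDerivAt (ultraWronskian α p) ((1 - x ^ 2) ^ (α / 2 + 1 / 4) / (1 - x ^ 2) *
      ((((k : ℝ) + α + 1 / 2) ^ 2 - 1) * (x ^ 2 - (1 - c)) * p.eval x)) x := by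
  have hA : 0 < 1 - x ^ 2 := by linarith
  have hA' : HasDerivAt (fun x : ℝ => 1 - x ^ 2) (-(2 * x)) x := by
    simpa using (hasDerivAt_pow 2 x).const_sub 1
  have hd := (hasDerivAt_sub_sq_rpow (α / 2 + 1 / 4) hx).mul
    ((hA'.mul ((derivative p).hasDerivAt x)).sub
      (((hasDerivAt_id x).const_mul (α - 1 / 2)).mul (p.hasDerivAt x)))
  refine hd.congr_deriv ?_
  have hode := h.eval_ode x
  simp only [Pi.mul_apply, Pi.sub_apply, id]
  generalize (1 - x ^ 2) ^ (α / 2 + 1 / 4) = a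
  field_simp
  linear_combination (16 * a * (1 - x ^ 2)) * hode - 16 * a * p.eval x * hrel

/-- Sturm comparison with `sin θ`, `x = cos θ`: to the right of `δ` a solution has no zero and the
logarithmic derivative of `(1 - x²)^((α - 1/2)/2) p` is nonpositive. -/
lemma IsUltraspherical.pos_of_delta_le {α c : ℝ} {k : ℕ} {p : ℝ[X]}
    (h : IsUltraspherical α k p) (hα : 1 / 2 < α)
    (hrel : c * (((k : ℝ) + α + 1 / 2) ^ 2 - 1) = α ^ 2 - 1 / 4)
    (hp : 0 < p.eval 1) {x : ℝ} (hx0 : 0 ≤ x) (hx : 1 - c ≤ x ^ 2) (hx1 : x < 1) :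
    0 < p.eval x ∧ (1 - x ^ 2) * (derivative p).eval x ≤ (α - 1 / 2) * x * p.eval x := by
  have hN := one_lt_add_half hα k
  have wron (x : ℝ) (hx0 : 0 ≤ x) (hx : 1 - c ≤ x ^ 2) (hx1 : x < 1)
      (hpos : ∀ y ∈ Ioc x 1, 0 < p.eval y) (y : ℝ) (hy : y ∈ Ico x 1) :
      (1 - y ^ 2) * (derivative p).eval y - (α - 1 / 2) * y * p.eval y ≤ 0 := by
    have hmono : MonotoneOn (ultraWronskian α p) (Icc x 1) := by
      have hd (y : ℝ) (hy : y ∈ Ioo x 1) := h.hasDerivAt_ultraWronskian hrel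
        (by nlinarith [hy.1, hy.2] : y ^ 2 < 1)
      refine monotoneOn_of_deriv_nonneg (convex_Icc _ _) (Continuous.continuousOn ?_)
        (fun y hy => ?_) fun y hy => ?_
      · exact (continuous_one_sub_sq_rpow (by linarith)).mul (by fun_prop)
      · rw [interior_Icc] at hy
        exact (hd y hy).differentiableAt.differentiableWithinAt
      · rw [interior_Icc] at hy
        rw [(hd y hy).deriv]
        have h1 : 0 < 1 - y ^ 2 := by nlinarith [hy.1, hy.2]
        have h2 := hpos y ⟨hy.1, hy.2.le⟩
        have h3 : 0 ≤ y ^ 2 - (1 - c) := by nlinarith [hy.1]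
        have h4 : 0 ≤ ((k : ℝ) + α + 1 / 2) ^ 2 - 1 := by nlinarith
        positivity
    have h1 := hmono (Ico_subset_Icc_self hy) (right_mem_Icc.2 hx1.le) hy.2.le
    have h0 : ultraWronskian α p 1 = 0 := by
      rw [ultraWronskian, one_pow, sub_self, Real.zero_rpow (by linarith), zero_mul]
    rw [h0, ultraWronskian] at h1
    have hA : 0 < 1 - y ^ 2 := by nlinarith [hy.1, hy.2]
    exact nonpos_of_mul_nonpos_right h1 (by positivity)
  have hpos (x : ℝ) (hx0 : 0 ≤ x) (hx : 1 - c ≤ x ^ 2) (hx1 : x ≤ 1) : 0 < p.eval x := by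
    by_contra! hneg
    -- `s` is the rightmost point of `[x, 1]` where `p ≤ 0`.
    obtain ⟨s, ⟨hs, hsp⟩, hmax⟩ := (isCompact_Icc.inter_right
      (isClosed_le p.continuous continuous_const)).exists_isGreatest
      ⟨x, (⟨⟨le_rfl, hx1⟩, hneg⟩ : x ∈ Icc x 1 ∩ {y | p.eval y ≤ 0})⟩
    have hs1 : s < 1 := lt_of_le_of_ne hs.2 (by rintro rfl; exact absurd hp (not_lt.2 hsp))
    have hs0 : 0 ≤ s := hx0.trans hs.1
    have hsc : 1 - c ≤ s ^ 2 := hx.trans (by nlinarith [hs.1])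
    have hright : ∀ y ∈ Ioc s 1, 0 < p.eval y := fun y hy => by
      by_contra! hy0
      exact absurd (hmax ⟨⟨hs.1.trans hy.1.le, hy.2⟩, hy0⟩) (not_le.2 hy.1)
    -- `(1 - x²)^((α - 1/2)/2) p` decreases on `[s, 1)`, so it is positive at `s` as well.
    have hanti : AntitoneOn (fun y => (1 - y ^ 2) ^ (α / 2 - 1 / 4) * p.eval y)
        (Icc s ((s + 1) / 2)) := by
      have hd (y : ℝ) (hy : y ∈ Icc s ((s + 1) / 2)) :=
        (hasDerivAt_sub_sq_rpow (α / 2 - 1 / 4) (by nlinarith [hy.1, hy.2] : y ^ 2 < 1)).mul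
          (p.hasDerivAt y)
      refine antitoneOn_of_deriv_nonpos (convex_Icc _ _)
        (fun y hy => (hd y hy).continuousAt.continuousWithinAt)
        (fun y hy => (hd y (interior_subset hy)).differentiableAt.differentiableWithinAt)
        fun y hy => ?_
      have hy := interior_subset hy
      refine (hd y hy).deriv.trans_le ?_
      have hA : 0 < 1 - y ^ 2 := by nlinarith [hy.1, hy.2]
      have e : -(2 * (α / 2 - 1 / 4) * y) / (1 - y ^ 2) * (1 - y ^ 2) ^ (α / 2 - 1 / 4) *
          p.eval y + (1 - y ^ 2) ^ (α / 2 - 1 / 4) * (derivative p).eval y =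
          (1 - y ^ 2) ^ (α / 2 - 1 / 4) / (1 - y ^ 2) *
            ((1 - y ^ 2) * (derivative p).eval y - (α - 1 / 2) * y * p.eval y) := by
        field_simp
        ring
      rw [e]
      exact mul_nonpos_of_nonneg_of_nonpos (by positivity)
        (wron s hs0 hsc hs1 hright y ⟨hy.1, by linarith [hy.2]⟩)
    have h1 := hanti (left_mem_Icc.2 (by linarith)) (right_mem_Icc.2 (by linarith))
      (by linarith : s ≤ (s + 1) / 2)
    have h2 := hright ((s + 1) / 2) ⟨by linarith, by linarith⟩
    have h3 : 0 < 1 - ((s + 1) / 2) ^ 2 := by nlinarith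
    have h4 : 0 < 1 - s ^ 2 := by nlinarith
    have h5 : 0 < (1 - ((s + 1) / 2) ^ 2) ^ (α / 2 - 1 / 4) * p.eval ((s + 1) / 2) := by
      positivity
    exact absurd (pos_of_mul_pos_right (h5.trans_le h1) (by positivity)) (not_lt.2 hsp)
  refine ⟨hpos x hx0 hx hx1.le, ?_⟩
  have := wron x hx0 hx hx1 (fun y hy => hpos y (hx0.trans hy.1.le)
    (hx.trans (by nlinarith [hy.1])) hy.2) x ⟨le_rfl, hx1⟩
  linarith

lemma ultraM_one_hasDerivAt_neg {α : ℝ} (hα : 1 / 2 < α) (k : ℕ) {x : ℝ}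
    (hx : ultraDelta α k ≤ x) (hx1 : x < 1) :
    ∃ d < 0, HasDerivAt (ultraM α k 1) d x := by
  have hδ := ultraDelta_pos hα k
  have hx0 : 0 < x := hδ.trans_le hx
  have hxc : 1 - ultraGap α k ≤ x ^ 2 := by
    rw [← ultraDelta_sq hα]; gcongr
  set p := orthonormalJacobi α α k with hp
  have hult : IsUltraspherical α k p := isUltraspherical_orthonormalJacobi k
  have hne : p.eval 1 ≠ 0 := eval_one_orthonormalJacobi_ne_zero (by linarith) k
  have hA : 0 < 1 - x ^ 2 := by nlinarith
  have key : p.eval x ≠ 0 ∧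
      p.eval x * ((1 - x ^ 2) * (derivative p).eval x) ≤ (α - 1 / 2) * x * p.eval x ^ 2 := by
    rcases hne.lt_or_gt with hlt | hgt
    · obtain ⟨h1, h2⟩ := (hult.C_mul (-1)).pos_of_delta_le hα (ultraGap_mul hα k)
        (by simpa using hlt) hx0.le hxc hx1
      simp only [derivative_C_mul, eval_mul, eval_C] at h1 h2
      exact ⟨by rintro h0; simp [h0] at h1, by nlinarith⟩
    · obtain ⟨h1, h2⟩ := hult.pos_of_delta_le hα (ultraGap_mul hα k) hgt hx0.le hxc hx1
      exact ⟨h1.ne', by nlinarith⟩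
  have hf : ultraM α k 1 =
      fun x => (1 - x ^ 2) ^ (1 / 2 : ℝ) * (1 - x ^ 2) ^ α * p.eval x ^ 2 := by
    funext x
    rw [ultraM, Real.sqrt_eq_rpow, one_pow]
  have hsq : x ^ 2 < 1 := by linarith
  have hd := ((hasDerivAt_sub_sq_rpow (1 / 2) hsq).mul (hasDerivAt_sub_sq_rpow α hsq)).mul
    ((p.hasDerivAt x).pow 2)
  refine ⟨(1 - x ^ 2) ^ (1 / 2 : ℝ) * (1 - x ^ 2) ^ α / (1 - x ^ 2) *
    (2 * (p.eval x * ((1 - x ^ 2) * (derivative p).eval x)) - (2 * α + 1) * x * p.eval x ^ 2),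
    ?_, ?_⟩
  · refine mul_neg_of_pos_of_neg (by positivity) ?_
    have : 0 < x * p.eval x ^ 2 := mul_pos hx0 (sq_pos_of_ne_zero key.1)
    nlinarith [key.2]
  · rw [hf]
    refine hd.congr_deriv ?_
    simp only [Pi.mul_apply, Pi.pow_apply]
    push_cast
    field_simp
    ring

lemma ultraM_neg {α : ℝ} (hα : 1 / 2 < α) (k : ℕ) (d x : ℝ) :
    ultraM α k d (-x) = ultraM α k d x := by
  unfold ultraM
  rw [(isUltraspherical_orthonormalJacobi k).eval_neg (by linarith)]
  simp [mul_pow, ← pow_mul, mul_comm k 2]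

lemma mem_Ioo_of_isLocalMaxOn {α : ℝ} (hα : 1 / 2 < α) (k : ℕ) {x : ℝ}
    (hx : x ∈ Icc (-1 : ℝ) 1) (hmax : IsLocalMaxOn (ultraM α k 1) (Icc (-1 : ℝ) 1) x) :
    x ∈ Ioo (-ultraDelta α k) (ultraDelta α k) := by
  set p := orthonormalJacobi α α k with hp
  by_cases hend : x ^ 2 = 1
  · -- The function vanishes at the endpoints and is positive nearby.
    exfalso
    have hpx : p.eval x ≠ 0 := by
      have h1 : p.eval 1 ≠ 0 := eval_one_orthonormalJacobi_ne_zero (by linarith) k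
      rcases eq_or_eq_neg_of_sq_eq_sq x 1 (by simpa using hend) with rfl | rfl
      · exact h1
      · rw [(isUltraspherical_orthonormalJacobi k).eval_neg (by linarith)]
        exact mul_ne_zero (pow_ne_zero _ (by norm_num)) h1
    have hfx : ultraM α k 1 x = 0 := by simp [ultraM, hend]
    have : (nhdsWithin x (Ioo (-1 : ℝ) 1)).NeBot := by
      rw [← mem_closure_iff_nhdsWithin_neBot, closure_Ioo (by norm_num)]
      exact hx
    have e1 := hmax.filter_mono (nhdsWithin_mono x Ioo_subset_Icc_self)
    have e2 : ∀ᶠ y in nhdsWithin x (Ioo (-1 : ℝ) 1), p.eval y ≠ 0 :=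
      (p.continuous.continuousAt.eventually_ne hpx).filter_mono nhdsWithin_le_nhds
    obtain ⟨y, hy1, hy2, hy3⟩ := (e1.and (e2.and self_mem_nhdsWithin)).exists
    have hA : 0 < 1 - y ^ 2 := by nlinarith [hy3.1, hy3.2]
    have hpos : 0 < ultraM α k 1 y := by
      unfold ultraM
      rw [one_pow]
      have := Real.sqrt_pos.2 hA
      positivity
    rw [hfx] at hy1
    linarith
  · have hxI : x ∈ Ioo (-1 : ℝ) 1 :=
      ⟨lt_of_le_of_ne hx.1 (by rintro rfl; norm_num at hend),
        lt_of_le_of_ne hx.2 (by rintro rfl; norm_num at hend)⟩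
    have hloc : IsLocalMax (ultraM α k 1) x := hmax.isLocalMax (Icc_mem_nhds hxI.1 hxI.2)
    by_contra hout
    rw [mem_Ioo, not_and_or, not_lt, not_lt] at hout
    rcases hout with hleft | hright
    · obtain ⟨d, hd, hder⟩ := ultraM_one_hasDerivAt_neg hα k (x := -x) (by linarith)
        (by linarith [hxI.1])
      have h2 := hder.scomp x (hasDerivAt_neg x)
      have e : ultraM α k 1 ∘ Neg.neg = ultraM α k 1 := funext fun y => ultraM_neg hα k 1 y
      have h3 := hloc.hasDerivAt_eq_zero (e ▸ h2)
      simp at h3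
      linarith
    · obtain ⟨d, hd, hder⟩ := ultraM_one_hasDerivAt_neg hα k hright hxI.2
      linarith [hloc.hasDerivAt_eq_zero hder]

theorem theorem3 (α : ℝ) (hα : 1 / 2 < α) (k : ℕ) :
    (Even k → 2 ≤ k →
      ∃ m : ℝ, IsGreatest (ultraM α k (ultraDelta α k) ''
          Icc (-ultraDelta α k) (ultraDelta α k)) m ∧
        m < 2 / Real.pi * (1 + 1 / (8 * ((k : ℝ) + α) ^ 2))) ∧
    (Odd k → 3 ≤ k →
      ∃ m : ℝ, IsGreatest (ultraM α k (ultraDelta α k) ''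
          Icc (-ultraDelta α k) (ultraDelta α k)) m ∧
        m < 230 / Real.pi) ∧
    (∀ x ∈ Icc (-1 : ℝ) 1, IsLocalMaxOn (ultraM α k 1) (Icc (-1 : ℝ) 1) x →
      x ∈ Ioo (-ultraDelta α k) (ultraDelta α k)) := by
  have hα0 : 0 < α := by linarith
  refine ⟨fun hk h2 => ?_, fun hk h3 => ?_, fun x hx hmax => mem_Ioo_of_isLocalMaxOn hα k hx hmax⟩
  · obtain ⟨m, rfl⟩ := even_iff_exists_two_mul.1 hk
    have hm : 1 ≤ m := by omega
    have hder : (derivative (orthonormalJacobi α α (2 * m))).eval 0 = 0 := by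
      obtain ⟨n, rfl⟩ := Nat.exists_eq_add_of_le' hm
      have h := (IsUltraspherical.diff (k := 2 * n + 1)
        (isUltraspherical_orthonormalJacobi (α := α) (2 * (n + 1)))).eval_neg (by linarith) 0
      rw [neg_zero, pow_succ, pow_mul] at h
      norm_num at h
      linarith
    refine exists_isGreatest_ultraM_lt hα0.le _ (ultraDelta_pos hα _).le
      (fun x hx => ?_) (even_bound hα hm)
    simpa [hder] using ultraM_ultraDelta_le hα (2 * m) hx
  · obtain ⟨m, rfl⟩ := hk
    have hval : (orthonormalJacobi α α (2 * m + 1)).eval 0 = 0 := by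
      have h := (isUltraspherical_orthonormalJacobi (α := α) (2 * m + 1)).eval_neg (by linarith) 0
      rw [neg_zero, pow_succ, pow_mul] at h
      norm_num at h
      linarith
    refine exists_isGreatest_ultraM_lt hα0.le _ (ultraDelta_pos hα _).le
      (fun x hx => ?_) ((odd_bound hα (by omega : 1 ≤ m)).trans_lt
        (by gcongr; norm_num))
    simpa [hval] using ultraM_ultraDelta_le hα (2 * m + 1) hx
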